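/- Let the Heisenberg group $\mathbb{H}$ be $\mathbb{R}^3$ with the group law $(x_1,y_1,z_1)*(x_2,y_2,z_2)=\left(x_1+x_2,\;y_1+y_2,\;z_1+z_2+\tfrac12(x_1y_2-y_1x_2)\right)$ and with the sub-Riemannian structure for which the fields $X_1=\partial_x-\tfrac y2\partial_z$ and $X_2=\partial_y+\tfrac x2\partial_z$ form an orthonormal frame of the horizontal distribution. A horizontal curve is a Lipschitz curve that is almost everywhere tangent to this distribution; its length is the integral of its speed in the frame $(X_1,X_2)$, and the distance $d$ between two points is the infimum of the lengths of the horizontal curves (on compact intervals) that link them. An isometry of $\mathbb{H}$ is a bijection preserving $d$. A geodesic on an interval $I$ is a curve $\gamma:I\to\mathbb{H}$ that is horizontal on each compact subinterval of $I$, has (almost everywhere) constant speed, and is such that, for every $t\in I$ and every $s\in I$ close enough to $t$, the length of $\gamma$ between the times $t$ and $s$ equals $d(\gamma(t),\gamma(s))$. For a smooth horizontal curve $\zeta=(x,y,z):\,]-T,T[\,\to\mathbb{H}$ parametrized by arc length (that is, $C^\infty$, everywhere tangent to the distribution, with $\dot x^2+\dot y^2=1$), the characteristic deviation is $h_\zeta=\dot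 x\ddot y-\dot y\ddot x$; equivalently $h_\zeta=\dot\theta$ if $\zeta'=\cos\theta\,X_1+\sin\theta\,X_2$ with $\theta$ smooth. Let $T>0$ be a real number. (i) If $\zeta_1,\zeta_2:\,]-T,T[\,\to\mathbb{H}$ are two smooth horizontal curves parametrized by arc length such that $h_{\zeta_1}(t)=h_{\zeta_2}(t)$ for every $t\in\,]-T,T[$, then there is an isometry $\iota$ of $\mathbb{H}$ such that $\zeta_2=\iota\circ\zeta_1$. Moreover $\iota$ can be taken of the form $L_u\circ R_\alpha$ with $u\in\mathbb{H}$ and $\alpha\in\mathbb{R}$, where $L_u(v)=u*v$ is the left translation by $u$ and $R_\alpha(x,y,z)=(x\cos\alpha+y\sin\alpha,\,-x\sin\alpha+y\cos\alpha,\,z)$ is a rotation about the $z$-axis. (ii) If $\zeta:\,]-T,T[\,\to\mathbb{H}$ is a smooth horizontal curve parametrized by arc length, then $\dot h_\zeta$ vanishes identically on $]-T,T[$ if and only if $\zeta$ is a geodesic on $]-T,T[$. -/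

import Mathlib

open scoped ContDiff Topology ENNReal
open Set MeasureTheory

noncomputable section

/-- The underlying space `ℝ³` of the Heisenberg group, with coordinates
`x = p.1`, `y = p.2.1`, `z = p.2.2`. The group law is `Heis.mul` below, not the componentwise
product. -/
abbrev Heis : Type := ℝ × ℝ × ℝ

namespace Heis

/-- The Heisenberg group law. -/
def mul (p q : Heis) : Heis :=
  (p.1 + q.1, p.2.1 + q.2.1, p.2.2 + q.2.2 + (1 / 2) * (p.1 * q.2.1 - p.2.1 * q.1))

/-- The left translation `v ↦ u * v`. -/
def leftTranslation (u : Heis) : Heis → Heis := fun v => mul u v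

/-- The rotation of angle parameter `α` about the `z`-axis. -/
def rotation (α : ℝ) : Heis → Heis := fun v =>
  (Real.cos α * v.1 + Real.sin α * v.2.1, -Real.sin α * v.1 + Real.cos α * v.2.1, v.2.2)

/-- The vector field `X₁ = ∂_x - (y/2) ∂_z`. -/
def X₁ (p : Heis) : Heis := (1, 0, -(p.2.1 / 2))

/-- The vector field `X₂ = ∂_y + (x/2) ∂_z`. -/
def X₂ (p : Heis) : Heis := (0, 1, p.1 / 2)

/-- The horizontal distribution, spanned at each point by `X₁` and `X₂`. -/
def distribution (p : Heis) : Submodule ℝ Heis := Submodule.span ℝ {X₁ p, X₂ p}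

/-- The frame coefficients of a horizontal vector are its first two coordinates. -/
theorem mem_distribution_iff (p v : Heis) :
    v ∈ distribution p ↔ v = v.1 • X₁ p + v.2.1 • X₂ p := by
  unfold distribution
  rw [Submodule.mem_span_pair]
  constructor
  · rintro ⟨a, b, rfl⟩
    simp [X₁, X₂]
  · intro h
    exact ⟨v.1, v.2.1, h.symm⟩

/-- The norm of a horizontal vector `a X₁ + b X₂`, for which `(X₁, X₂)` is orthonormal:
`√(a² + b²)`, where `a` and `b` are the first two coordinates of the vector
(see `mem_distribution_iff`). -/
def horNorm (v : Heis) : ℝ := √(v.1 ^ 2 + v.2.1 ^ 2)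

/-- `γ` restricted to `[a, b]` is a horizontal curve: it is Lipschitz and almost everywhere
tangent to the distribution. (Its speed in the frame is then automatically measurable and
essentially bounded, by the Lipschitz condition.) -/
def IsHorizontalCurve (γ : ℝ → Heis) (a b : ℝ) : Prop :=
  (∃ K, LipschitzOnWith K γ (Icc a b)) ∧
    ∀ᵐ t ∂(volume.restrict (Icc a b)),
      DifferentiableAt ℝ γ t ∧ deriv γ t ∈ distribution (γ t)

/-- The length of a horizontal curve `γ` between the times `a ≤ b`. -/
def length (γ : ℝ → Heis) (a b : ℝ) : ℝ≥0∞ :=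
  ∫⁻ t in Icc a b, ENNReal.ofReal (horNorm (deriv γ t))

/-- The sub-Riemannian distance: the infimum of the lengths of the horizontal curves that
link `p` to `q`. -/
def ccDist (p q : Heis) : ℝ≥0∞ :=
  sInf {l | ∃ (a b : ℝ) (γ : ℝ → Heis), a ≤ b ∧ IsHorizontalCurve γ a b ∧
    γ a = p ∧ γ b = q ∧ l = length γ a b}

/-- Isometries of the Heisenberg group: bijections that preserve the sub-Riemannian distance. -/
def IsHeisIsometry (f : Heis → Heis) : Prop :=
  Function.Bijective f ∧ ∀ p q, ccDist (f p) (f q) = ccDist p q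

/-- `γ` is a geodesic on the interval `I`: a horizontal curve of constant speed such that for each
`t ∈ I` and for `s ∈ I` close enough to `t`, the length of `γ` between the times `t` and `s` is
the distance between `γ t` and `γ s`. -/
def IsGeodesicOn (γ : ℝ → Heis) (I : Set ℝ) : Prop :=
  (∀ a b, Icc a b ⊆ I → IsHorizontalCurve γ a b) ∧
  (∃ c : ℝ, ∀ᵐ t ∂(volume.restrict I), horNorm (deriv γ t) = c) ∧
  ∀ t ∈ I, ∀ᶠ s in 𝓝[I] t, length γ (min t s) (max t s) = ccDist (γ t) (γ s)

/-- `ζ` restricted to `]-T, T[` is a smooth horizontal curve parametrized by arc length. -/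
structure IsSmoothArcLengthCurve (ζ : ℝ → Heis) (T : ℝ) : Prop where
  smooth : ContDiffOn ℝ ∞ ζ (Ioo (-T) T)
  horizontal : ∀ t ∈ Ioo (-T) T, deriv ζ t ∈ distribution (ζ t)
  unit_speed : ∀ t ∈ Ioo (-T) T, horNorm (deriv ζ t) = 1

/-- The characteristic deviation `h_ζ = x' y'' - y' x''`. -/
def charDev (ζ : ℝ → Heis) (t : ℝ) : ℝ :=
  deriv (fun s => (ζ s).1) t * deriv (deriv (fun s => (ζ s).2.1)) t
    - deriv (fun s => (ζ s).2.1) t * deriv (deriv (fun s => (ζ s).1)) t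

end Heis

end

namespace Heis

/-! Part (i). The planar velocity of an arc-length curve satisfies the Frenet system x'' = -h y',
y'' = h x'. Two curves with the same h have velocities with constant inner and cross products, so
one velocity is a fixed rotation of the other. A left translation matches the points at time 0, and
integration does the rest, horizontality determining z' (`exists_rigidMotion_of_charDev_eq`).

Part (ii) rests on the coordinate w = z + xy/2, for which w' = x y' along horizontal curves, and on
a rotation that makes the velocity at the given time equal to X₁.

If h = l is constant, then y' = l x + c, and near that time x' = √(1 - (l x + c)²). The function
F(x) + l w + c y, with F' = √(1 - (l x + c)²), has a horizontal gradient of norm one in the strip |l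
x + c| ≤ 1 and grows at unit rate along the curve. It calibrates short arcs, since a shorter
competitor cannot leave the strip (`ofReal_sub_le_ccDist`).

Conversely, on a minimizing arc keep x and replace y' by its L² projection A + B x on the span of 1
and x. The two orthogonality relations are exactly the conditions that the endpoints in y and w be
unchanged, and Pythagoras makes the competitor strictly shorter unless y' = A + B x
(`exists_deriv_snd_eq_affine`). Differentiating gives h x' = B x', hence h = B. -/

theorem mem_distribution_iff_snd_snd (p v : Heis) :
    v ∈ distribution p ↔ v.2.2 = (p.1 * v.2.1 - p.2.1 * v.1) / 2 := by
  rw [mem_distribution_iff]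
  obtain ⟨a, b, c⟩ := v
  simp only [X₁, X₂, Prod.smul_mk, smul_eq_mul, Prod.mk_add_mk, Prod.mk.injEq]
  constructor
  · rintro ⟨-, -, h⟩
    rw [h]; ring
  · intro h
    refine ⟨by ring, by ring, ?_⟩
    rw [h]; ring

theorem hasDerivAt_x {γ : ℝ → Heis} {v : Heis} {t : ℝ} (h : HasDerivAt γ v t) :
    HasDerivAt (fun s => (γ s).1) v.1 t :=
  (ContinuousLinearMap.fst ℝ ℝ (ℝ × ℝ)).hasFDerivAt.comp_hasDerivAt t h

theorem hasDerivAt_y {γ : ℝ → Heis} {v : Heis} {t : ℝ} (h : HasDerivAt γ v t) :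
    HasDerivAt (fun s => (γ s).2.1) v.2.1 t :=
  ((ContinuousLinearMap.fst ℝ ℝ ℝ).comp
    (ContinuousLinearMap.snd ℝ ℝ (ℝ × ℝ))).hasFDerivAt.comp_hasDerivAt t h

theorem hasDerivAt_z {γ : ℝ → Heis} {v : Heis} {t : ℝ} (h : HasDerivAt γ v t) :
    HasDerivAt (fun s => (γ s).2.2) v.2.2 t :=
  ((ContinuousLinearMap.snd ℝ ℝ ℝ).comp
    (ContinuousLinearMap.snd ℝ ℝ (ℝ × ℝ))).hasFDerivAt.comp_hasDerivAt t h

theorem ccDist_le_length {γ : ℝ → Heis} {a b : ℝ} (hab : a ≤ b) (h : IsHorizontalCurve γ a b) :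
    ccDist (γ a) (γ b) ≤ length γ a b :=
  sInf_le ⟨a, b, γ, hab, h, rfl, rfl, rfl⟩

/-! ### Rigid motions and their isometry property -/

/-- The composition of a left translation and a rotation about the `z`-axis. -/
noncomputable def rigidMotion (u : Heis) (α : ℝ) : Heis → Heis := leftTranslation u ∘ rotation α

theorem rigidMotion_apply (u : Heis) (α : ℝ) (v : Heis) :
    rigidMotion u α v =
      (u.1 + (Real.cos α * v.1 + Real.sin α * v.2.1),
        u.2.1 + (-Real.sin α * v.1 + Real.cos α * v.2.1),
        u.2.2 + v.2.2 + (1 / 2) * (u.1 * (-Real.sin α * v.1 + Real.cos α * v.2.1)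
          - u.2.1 * (Real.cos α * v.1 + Real.sin α * v.2.1))) := rfl

/-- The linear part of a rigid motion. -/
noncomputable def rigidMotionLinear (u : Heis) (α : ℝ) : Heis →L[ℝ] Heis :=
  LinearMap.toContinuousLinearMap
    { toFun := fun v =>
        (Real.cos α * v.1 + Real.sin α * v.2.1,
          -Real.sin α * v.1 + Real.cos α * v.2.1,
          v.2.2 + (1 / 2) * (u.1 * (-Real.sin α * v.1 + Real.cos α * v.2.1)
            - u.2.1 * (Real.cos α * v.1 + Real.sin α * v.2.1)))
      map_add' := fun v w => by
        simp only [Prod.fst_add, Prod.snd_add, Prod.mk_add_mk, Prod.mk.injEq]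
        refine ⟨?_, ?_, ?_⟩ <;> ring
      map_smul' := fun r v => by
        simp only [Prod.smul_fst, Prod.smul_snd, Prod.smul_mk, smul_eq_mul, RingHom.id_apply,
          Prod.mk.injEq]
        refine ⟨?_, ?_, ?_⟩ <;> ring }

theorem rigidMotionLinear_apply (u : Heis) (α : ℝ) (v : Heis) :
    rigidMotionLinear u α v =
      (Real.cos α * v.1 + Real.sin α * v.2.1,
        -Real.sin α * v.1 + Real.cos α * v.2.1,
        v.2.2 + (1 / 2) * (u.1 * (-Real.sin α * v.1 + Real.cos α * v.2.1)
          - u.2.1 * (Real.cos α * v.1 + Real.sin α * v.2.1))) := rfl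

theorem rigidMotion_eq_add (u : Heis) (α : ℝ) :
    rigidMotion u α = fun v => u + rigidMotionLinear u α v := by
  funext v
  rw [rigidMotion_apply, rigidMotionLinear_apply]
  refine Prod.ext rfl (Prod.ext rfl ?_)
  simp only [Prod.snd_add]
  ring

theorem contDiff_rigidMotion (u : Heis) (α : ℝ) : ContDiff ℝ ∞ (rigidMotion u α) := by
  rw [rigidMotion_eq_add]
  exact contDiff_const.add (rigidMotionLinear u α).contDiff

theorem hasDerivAt_rigidMotion_comp (u : Heis) (α : ℝ) {γ : ℝ → Heis} {v : Heis} {t : ℝ}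
    (h : HasDerivAt γ v t) : HasDerivAt (rigidMotion u α ∘ γ) (rigidMotionLinear u α v) t := by
  rw [rigidMotion_eq_add]
  exact ((rigidMotionLinear u α).hasFDerivAt.comp_hasDerivAt t h).const_add u

theorem lipschitzWith_rigidMotion (u : Heis) (α : ℝ) : ∃ K, LipschitzWith K (rigidMotion u α) := by
  refine ⟨‖rigidMotionLinear u α‖₊, ?_⟩
  rw [rigidMotion_eq_add]
  intro v w
  simpa using (rigidMotionLinear u α).lipschitz v w

theorem horNorm_rigidMotionLinear (u : Heis) (α : ℝ) (v : Heis) :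
    horNorm (rigidMotionLinear u α v) = horNorm v := by
  rw [rigidMotionLinear_apply]
  unfold horNorm
  congr 1
  linear_combination (v.1 ^ 2 + v.2.1 ^ 2) * Real.sin_sq_add_cos_sq α

theorem rigidMotionLinear_mem_distribution (u : Heis) (α : ℝ) {p v : Heis}
    (h : v ∈ distribution p) : rigidMotionLinear u α v ∈ distribution (rigidMotion u α p) := by
  rw [mem_distribution_iff_snd_snd] at *
  rw [rigidMotionLinear_apply, rigidMotion_apply]
  simp only
  rw [h]
  linear_combination
    (-(p.1 * v.2.1 - p.2.1 * v.1) / 2) * Real.sin_sq_add_cos_sq α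

theorem IsHorizontalCurve.rigidMotion_comp (u : Heis) (α : ℝ) {γ : ℝ → Heis} {a b : ℝ}
    (h : IsHorizontalCurve γ a b) : IsHorizontalCurve (rigidMotion u α ∘ γ) a b := by
  obtain ⟨⟨K, hK⟩, h⟩ := h
  obtain ⟨M, hM⟩ := lipschitzWith_rigidMotion u α
  refine ⟨⟨M * K, hM.comp_lipschitzOnWith hK⟩, ?_⟩
  filter_upwards [h] with t ⟨h1, h2⟩
  have h3 := hasDerivAt_rigidMotion_comp u α h1.hasDerivAt
  refine ⟨h3.differentiableAt, ?_⟩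
  rw [h3.deriv]
  exact rigidMotionLinear_mem_distribution u α h2

theorem IsHorizontalCurve.length_rigidMotion_comp (u : Heis) (α : ℝ) {γ : ℝ → Heis} {a b : ℝ}
    (h : IsHorizontalCurve γ a b) : length (rigidMotion u α ∘ γ) a b = length γ a b := by
  unfold length
  refine lintegral_congr_ae ?_
  filter_upwards [h.2] with t ⟨h1, _⟩
  rw [(hasDerivAt_rigidMotion_comp u α h1.hasDerivAt).deriv, horNorm_rigidMotionLinear]

theorem ccDist_rigidMotion_le (u : Heis) (α : ℝ) (p q : Heis) :
    ccDist (rigidMotion u α p) (rigidMotion u α q) ≤ ccDist p q := by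
  refine le_sInf ?_
  rintro l ⟨a, b, γ, hab, hγ, rfl, rfl, rfl⟩
  rw [← hγ.length_rigidMotion_comp u α]
  exact ccDist_le_length hab (hγ.rigidMotion_comp u α)

/-- Rotations are group automorphisms and the inverse of u is -u, so the inverse of L_u ∘ R_α is
R_{-α} ∘ L_{-u} = L_{R_{-α}(-u)} ∘ R_{-α}, again a rigid motion. -/
theorem rigidMotion_leftInverse (u : Heis) (α : ℝ) :
    Function.LeftInverse (rigidMotion (rotation (-α) (-u)) (-α)) (rigidMotion u α) := by
  intro v
  have h := Real.sin_sq_add_cos_sq α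
  simp only [rigidMotion_apply, rotation, Real.cos_neg, Real.sin_neg, Prod.fst_neg, Prod.snd_neg]
  refine Prod.ext ?_ (Prod.ext ?_ ?_)
  · linear_combination v.1 * h
  · linear_combination v.2.1 * h
  · linear_combination
      ((1 / 2) * (u.2.1 * (Real.cos α * v.1 + Real.sin α * v.2.1)
        - u.1 * (-Real.sin α * v.1 + Real.cos α * v.2.1))) * h

theorem rigidMotion_rightInverse (u : Heis) (α : ℝ) :
    Function.RightInverse (rigidMotion (rotation (-α) (-u)) (-α)) (rigidMotion u α) := by
  intro v
  have h := Real.sin_sq_add_cos_sq α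
  simp only [rigidMotion_apply, rotation, Real.cos_neg, Real.sin_neg, Prod.fst_neg, Prod.snd_neg]
  refine Prod.ext ?_ (Prod.ext ?_ ?_)
  · linear_combination (v.1 - u.1) * h
  · linear_combination (v.2.1 - u.2.1) * h
  · simp only
    ring

theorem ccDist_rigidMotion (u : Heis) (α : ℝ) (p q : Heis) :
    ccDist (rigidMotion u α p) (rigidMotion u α q) = ccDist p q := by
  refine le_antisymm (ccDist_rigidMotion_le u α p q) ?_
  have h := ccDist_rigidMotion_le (rotation (-α) (-u)) (-α)
    (rigidMotion u α p) (rigidMotion u α q)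
  rwa [rigidMotion_leftInverse u α p, rigidMotion_leftInverse u α q] at h

theorem isHeisIsometry_rigidMotion (u : Heis) (α : ℝ) : IsHeisIsometry (rigidMotion u α) :=
  ⟨⟨(rigidMotion_leftInverse u α).injective, (rigidMotion_rightInverse u α).surjective⟩,
    ccDist_rigidMotion u α⟩

/-! ### Symmetry of the distance -/

theorem restrict_Icc_neg (a b : ℝ) :
    MeasurePreserving (fun t : ℝ => -t) (volume.restrict (Icc (-b) (-a)))
      (volume.restrict (Icc a b)) := by
  have h := (Measure.measurePreserving_neg (volume : Measure ℝ)).restrict_preimage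
    (measurableSet_Icc (a := a) (b := b))
  have e : Neg.neg ⁻¹' Icc a b = Icc (-b) (-a) := by simp
  exact e ▸ h

/-- Time reversal keeps a curve horizontal and preserves its length. The symmetry handles times s <
t in the definition of a geodesic. -/
theorem ccDist_le_ccDist_swap (p q : Heis) : ccDist p q ≤ ccDist q p := by
  refine le_sInf ?_
  rintro l ⟨a, b, γ, hab, ⟨⟨K, hK⟩, hγ⟩, rfl, rfl, rfl⟩
  have hmp := restrict_Icc_neg a b
  have hder : ∀ t, HasDerivAt γ (deriv γ (-t)) (-t) →
      HasDerivAt (fun s => γ (-s)) (-deriv γ (-t)) t := fun t ht => by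
    have h := ht.scomp t (hasDerivAt_neg t)
    rw [neg_one_smul] at h
    exact h
  have hae := hmp.quasiMeasurePreserving.ae hγ
  have hhor : IsHorizontalCurve (fun s => γ (-s)) (-b) (-a) := by
    refine ⟨⟨K, ?_⟩, ?_⟩
    · intro s hs t ht
      have := hK (x := -s) ⟨by linarith [hs.2], by linarith [hs.1]⟩
        (y := -t) ⟨by linarith [ht.2], by linarith [ht.1]⟩
      simpa using this
    · filter_upwards [hae] with t ⟨h1, h2⟩
      have := hder t h1.hasDerivAt
      refine ⟨this.differentiableAt, ?_⟩
      rw [this.deriv]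
      exact Submodule.neg_mem _ h2
  have hlen : length (fun s => γ (-s)) (-b) (-a) = length γ a b := by
    unfold length
    have e : MeasurableEmbedding (fun t : ℝ => -t) := (MeasurableEquiv.neg ℝ).measurableEmbedding
    rw [← hmp.lintegral_comp_emb e]
    refine lintegral_congr_ae ?_
    filter_upwards [hae] with t ⟨h1, _⟩
    rw [(hder t h1.hasDerivAt).deriv]
    simp [horNorm]
  rw [← hlen]
  have := ccDist_le_length (neg_le_neg hab) hhor
  simpa using this

theorem ccDist_comm (p q : Heis) : ccDist p q = ccDist q p :=
  le_antisymm (ccDist_le_ccDist_swap p q) (ccDist_le_ccDist_swap q p)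

/-! ### Frenet equations of arc-length curves -/

namespace IsSmoothArcLengthCurve

variable {ζ : ℝ → Heis} {T t : ℝ}

theorem hasDerivAt (h : IsSmoothArcLengthCurve ζ T) (ht : t ∈ Ioo (-T) T) :
    HasDerivAt ζ (deriv ζ t) t :=
  ((h.smooth.contDiffAt (isOpen_Ioo.mem_nhds ht)).differentiableAt (by simp)).hasDerivAt

theorem contDiffOn_x (h : IsSmoothArcLengthCurve ζ T) :
    ContDiffOn ℝ ∞ (fun s => (ζ s).1) (Ioo (-T) T) :=
  contDiff_fst.comp_contDiffOn h.smooth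

theorem contDiffOn_y (h : IsSmoothArcLengthCurve ζ T) :
    ContDiffOn ℝ ∞ (fun s => (ζ s).2.1) (Ioo (-T) T) :=
  (contDiff_fst.comp contDiff_snd).comp_contDiffOn h.smooth

theorem contDiffOn_deriv_x (h : IsSmoothArcLengthCurve ζ T) :
    ContDiffOn ℝ ∞ (deriv fun s => (ζ s).1) (Ioo (-T) T) :=
  h.contDiffOn_x.deriv_of_isOpen isOpen_Ioo (by simp)

theorem contDiffOn_deriv_y (h : IsSmoothArcLengthCurve ζ T) :
    ContDiffOn ℝ ∞ (deriv fun s => (ζ s).2.1) (Ioo (-T) T) :=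
  h.contDiffOn_y.deriv_of_isOpen isOpen_Ioo (by simp)

theorem contDiffOn_charDev (h : IsSmoothArcLengthCurve ζ T) :
    ContDiffOn ℝ ∞ (charDev ζ) (Ioo (-T) T) :=
  (h.contDiffOn_deriv_x.mul (h.contDiffOn_deriv_y.deriv_of_isOpen isOpen_Ioo (by simp))).sub
    (h.contDiffOn_deriv_y.mul (h.contDiffOn_deriv_x.deriv_of_isOpen isOpen_Ioo (by simp)))

theorem hasDerivAt_of_contDiffOn {f : ℝ → ℝ} (h : ContDiffOn ℝ ∞ f (Ioo (-T) T))
    (ht : t ∈ Ioo (-T) T) : HasDerivAt f (deriv f t) t :=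
  ((h.contDiffAt (isOpen_Ioo.mem_nhds ht)).differentiableAt (by simp)).hasDerivAt

theorem hasDerivAt_fst (h : IsSmoothArcLengthCurve ζ T) (ht : t ∈ Ioo (-T) T) :
    HasDerivAt (fun s => (ζ s).1) (deriv (fun s => (ζ s).1) t) t :=
  hasDerivAt_of_contDiffOn h.contDiffOn_x ht

theorem hasDerivAt_snd (h : IsSmoothArcLengthCurve ζ T) (ht : t ∈ Ioo (-T) T) :
    HasDerivAt (fun s => (ζ s).2.1) (deriv (fun s => (ζ s).2.1) t) t :=
  hasDerivAt_of_contDiffOn h.contDiffOn_y ht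

theorem deriv_fst (h : IsSmoothArcLengthCurve ζ T) (ht : t ∈ Ioo (-T) T) :
    deriv (fun s => (ζ s).1) t = (deriv ζ t).1 := (hasDerivAt_x (h.hasDerivAt ht)).deriv

theorem deriv_snd (h : IsSmoothArcLengthCurve ζ T) (ht : t ∈ Ioo (-T) T) :
    deriv (fun s => (ζ s).2.1) t = (deriv ζ t).2.1 := (hasDerivAt_y (h.hasDerivAt ht)).deriv

theorem hasDerivAt_trd (h : IsSmoothArcLengthCurve ζ T) (ht : t ∈ Ioo (-T) T) :
    HasDerivAt (fun s => (ζ s).2.2) (((ζ t).1 * deriv (fun s => (ζ s).2.1) t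
      - (ζ t).2.1 * deriv (fun s => (ζ s).1) t) / 2) t := by
  rw [h.deriv_fst ht, h.deriv_snd ht, ← (mem_distribution_iff_snd_snd _ _).1 (h.horizontal t ht)]
  exact hasDerivAt_z (h.hasDerivAt ht)

theorem sq_add_sq (h : IsSmoothArcLengthCurve ζ T) (ht : t ∈ Ioo (-T) T) :
    deriv (fun s => (ζ s).1) t ^ 2 + deriv (fun s => (ζ s).2.1) t ^ 2 = 1 := by
  rw [h.deriv_fst ht, h.deriv_snd ht]
  have := h.unit_speed t ht
  rwa [horNorm, Real.sqrt_eq_one] at this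

theorem velocity_inner_acceleration (h : IsSmoothArcLengthCurve ζ T) (ht : t ∈ Ioo (-T) T) :
    deriv (fun s => (ζ s).1) t * deriv (deriv fun s => (ζ s).1) t
      + deriv (fun s => (ζ s).2.1) t * deriv (deriv fun s => (ζ s).2.1) t = 0 := by
  have h1 := ((hasDerivAt_of_contDiffOn h.contDiffOn_deriv_x ht).pow 2).add
    ((hasDerivAt_of_contDiffOn h.contDiffOn_deriv_y ht).pow 2)
  have h2 := (hasDerivAt_const t (1 : ℝ)).congr_of_eventuallyEq
    (f₁ := fun s => deriv (fun s => (ζ s).1) s ^ 2 + deriv (fun s => (ζ s).2.1) s ^ 2) (by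
      filter_upwards [isOpen_Ioo.mem_nhds ht] with s hs using h.sq_add_sq hs)
  have h3 := h1.unique h2
  norm_num at h3
  linarith

/-- Unit speed makes the acceleration orthogonal to the velocity, so it is a multiple of the
velocity turned by a quarter turn; the factor is the determinant of velocity and acceleration, which
is the characteristic deviation. -/
theorem hasDerivAt_deriv_fst (h : IsSmoothArcLengthCurve ζ T) (ht : t ∈ Ioo (-T) T) :
    HasDerivAt (deriv fun s => (ζ s).1) (-charDev ζ t * deriv (fun s => (ζ s).2.1) t) t := by
  convert! hasDerivAt_of_contDiffOn h.contDiffOn_deriv_x ht using 1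
  unfold charDev
  linear_combination (-deriv (fun s => (ζ s).1) t) * h.velocity_inner_acceleration ht
    + deriv (deriv fun s => (ζ s).1) t * h.sq_add_sq ht

theorem hasDerivAt_deriv_snd (h : IsSmoothArcLengthCurve ζ T) (ht : t ∈ Ioo (-T) T) :
    HasDerivAt (deriv fun s => (ζ s).2.1) (charDev ζ t * deriv (fun s => (ζ s).1) t) t := by
  convert! hasDerivAt_of_contDiffOn h.contDiffOn_deriv_y ht using 1
  unfold charDev
  linear_combination (-deriv (fun s => (ζ s).2.1) t) * h.velocity_inner_acceleration ht
    + deriv (deriv fun s => (ζ s).2.1) t * h.sq_add_sq ht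

theorem rigidMotion_comp (u : Heis) (α : ℝ) (h : IsSmoothArcLengthCurve ζ T) :
    IsSmoothArcLengthCurve (rigidMotion u α ∘ ζ) T where
  smooth := (contDiff_rigidMotion u α).comp_contDiffOn h.smooth
  horizontal t ht := by
    rw [(hasDerivAt_rigidMotion_comp u α (h.hasDerivAt ht)).deriv]
    exact rigidMotionLinear_mem_distribution u α (h.horizontal t ht)
  unit_speed t ht := by
    rw [(hasDerivAt_rigidMotion_comp u α (h.hasDerivAt ht)).deriv, horNorm_rigidMotionLinear]
    exact h.unit_speed t ht

theorem deriv_rigidMotion_comp_fst (u : Heis) (α : ℝ) (h : IsSmoothArcLengthCurve ζ T)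
    (ht : t ∈ Ioo (-T) T) :
    deriv (fun s => ((rigidMotion u α ∘ ζ) s).1) t
      = Real.cos α * deriv (fun s => (ζ s).1) t + Real.sin α * deriv (fun s => (ζ s).2.1) t :=
  ((((h.hasDerivAt_fst ht).const_mul _).add ((h.hasDerivAt_snd ht).const_mul _)).const_add _).deriv

theorem deriv_rigidMotion_comp_snd (u : Heis) (α : ℝ) (h : IsSmoothArcLengthCurve ζ T)
    (ht : t ∈ Ioo (-T) T) :
    deriv (fun s => ((rigidMotion u α ∘ ζ) s).2.1) t
      = -Real.sin α * deriv (fun s => (ζ s).1) t + Real.cos α * deriv (fun s => (ζ s).2.1) t :=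
  ((((h.hasDerivAt_fst ht).const_mul _).add ((h.hasDerivAt_snd ht).const_mul _)).const_add _).deriv

theorem charDev_rigidMotion_comp (u : Heis) (α : ℝ) (h : IsSmoothArcLengthCurve ζ T)
    (ht : t ∈ Ioo (-T) T) : charDev (rigidMotion u α ∘ ζ) t = charDev ζ t := by
  have hx : deriv (deriv fun s => ((rigidMotion u α ∘ ζ) s).1) t = _ :=
    ((((hasDerivAt_of_contDiffOn h.contDiffOn_deriv_x ht).const_mul (Real.cos α)).add
      ((hasDerivAt_of_contDiffOn h.contDiffOn_deriv_y ht).const_mul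
        (Real.sin α))).congr_of_eventuallyEq (by
      filter_upwards [isOpen_Ioo.mem_nhds ht] with s hs
      exact h.deriv_rigidMotion_comp_fst u α hs)).deriv
  have hy : deriv (deriv fun s => ((rigidMotion u α ∘ ζ) s).2.1) t = _ :=
    ((((hasDerivAt_of_contDiffOn h.contDiffOn_deriv_x ht).const_mul (-Real.sin α)).add
      ((hasDerivAt_of_contDiffOn h.contDiffOn_deriv_y ht).const_mul
        (Real.cos α))).congr_of_eventuallyEq (by
      filter_upwards [isOpen_Ioo.mem_nhds ht] with s hs
      exact h.deriv_rigidMotion_comp_snd u α hs)).deriv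
  unfold charDev
  rw [hx, hy, h.deriv_rigidMotion_comp_fst u α ht, h.deriv_rigidMotion_comp_snd u α ht]
  linear_combination (deriv (fun s => (ζ s).1) t * deriv (deriv fun s => (ζ s).2.1) t
    - deriv (fun s => (ζ s).2.1) t * deriv (deriv fun s => (ζ s).1) t)
      * Real.sin_sq_add_cos_sq α

end IsSmoothArcLengthCurve

/-! ### The characteristic deviation determines the curve up to a rigid motion -/

theorem eqOn_Ioo_of_hasDerivAt {f g f' : ℝ → ℝ} {T : ℝ}
    (hf : ∀ t ∈ Ioo (-T) T, HasDerivAt f (f' t) t) (hg : ∀ t ∈ Ioo (-T) T, HasDerivAt g (f' t) t)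
    (h0 : f 0 = g 0) : ∀ t ∈ Ioo (-T) T, f t = g t := by
  intro t ht
  have hT : 0 < T := by linarith [ht.1, ht.2]
  exact isOpen_Ioo.eqOn_of_deriv_eq isPreconnected_Ioo
    (fun t ht => (hf t ht).differentiableAt.differentiableWithinAt)
    (fun t ht => (hg t ht).differentiableAt.differentiableWithinAt)
    (fun t ht => by rw [(hf t ht).deriv, (hg t ht).deriv])
    (⟨by linarith, hT⟩ : (0 : ℝ) ∈ Ioo (-T) T) h0 ht

theorem exists_cos_sin_eq {a b : ℝ} (h : a ^ 2 + b ^ 2 = 1) :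
    ∃ α, Real.cos α = a ∧ Real.sin α = b := by
  have hn : ‖(⟨a, b⟩ : ℂ)‖ = 1 := by
    rw [Complex.norm_eq_sqrt_sq_add_sq, h, Real.sqrt_one]
  refine ⟨Complex.arg ⟨a, b⟩, ?_, ?_⟩
  · simpa [hn] using Complex.norm_mul_cos_arg ⟨a, b⟩
  · simpa [hn] using Complex.norm_mul_sin_arg ⟨a, b⟩

theorem exists_rigidMotion_of_charDev_eq {ζ₁ ζ₂ : ℝ → Heis} {T : ℝ} (hT : 0 < T)
    (h₁ : IsSmoothArcLengthCurve ζ₁ T) (h₂ : IsSmoothArcLengthCurve ζ₂ T)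
    (h : ∀ t ∈ Ioo (-T) T, charDev ζ₁ t = charDev ζ₂ t) :
    ∃ u α, ∀ t ∈ Ioo (-T) T, ζ₂ t = rigidMotion u α (ζ₁ t) := by
  have h0 : (0 : ℝ) ∈ Ioo (-T) T := ⟨by linarith, hT⟩
  set x₁ := fun s => (ζ₁ s).1
  set y₁ := fun s => (ζ₁ s).2.1
  set x₂ := fun s => (ζ₂ s).1
  set y₂ := fun s => (ζ₂ s).2.1
  -- The inner and cross products of the two initial unit velocities; Lagrange's identity gives the
  -- sum of squares 1.
  obtain ⟨α, hc, hs⟩ := exists_cos_sin_eq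
    (a := deriv x₁ 0 * deriv x₂ 0 + deriv y₁ 0 * deriv y₂ 0)
    (b := deriv y₁ 0 * deriv x₂ 0 - deriv x₁ 0 * deriv y₂ 0) (by
      linear_combination (deriv x₂ 0 ^ 2 + deriv y₂ 0 ^ 2) * h₁.sq_add_sq h0 + h₂.sq_add_sq h0)
  have hcos : ∀ t ∈ Ioo (-T) T, deriv x₁ t * deriv x₂ t + deriv y₁ t * deriv y₂ t = Real.cos α :=
    eqOn_Ioo_of_hasDerivAt (f' := fun _ => 0) (fun t ht => by
      convert! ((h₁.hasDerivAt_deriv_fst ht).mul (h₂.hasDerivAt_deriv_fst ht)).add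
        ((h₁.hasDerivAt_deriv_snd ht).mul (h₂.hasDerivAt_deriv_snd ht)) using 1
      rw [h t ht]; ring) (fun t _ => hasDerivAt_const t _) hc.symm
  have hsin : ∀ t ∈ Ioo (-T) T, deriv y₁ t * deriv x₂ t - deriv x₁ t * deriv y₂ t = Real.sin α :=
    eqOn_Ioo_of_hasDerivAt (f' := fun _ => 0) (fun t ht => by
      convert! ((h₁.hasDerivAt_deriv_snd ht).mul (h₂.hasDerivAt_deriv_fst ht)).sub
        ((h₁.hasDerivAt_deriv_fst ht).mul (h₂.hasDerivAt_deriv_snd ht)) using 1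
      rw [h t ht]; ring) (fun t _ => hasDerivAt_const t _) hs.symm
  have hx' : ∀ t ∈ Ioo (-T) T, deriv x₂ t = Real.cos α * deriv x₁ t + Real.sin α * deriv y₁ t :=
    fun t ht => by
      rw [← hcos t ht, ← hsin t ht]
      linear_combination (-deriv x₂ t) * h₁.sq_add_sq ht
  have hy' : ∀ t ∈ Ioo (-T) T, deriv y₂ t = -Real.sin α * deriv x₁ t + Real.cos α * deriv y₁ t :=
    fun t ht => by
      rw [← hcos t ht, ← hsin t ht]
      linear_combination (-deriv y₂ t) * h₁.sq_add_sq ht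
  obtain ⟨u, hu⟩ : ∃ u, ζ₂ 0 = rigidMotion u α (ζ₁ 0) := by
    set v := rotation α (ζ₁ 0) with hv
    -- This is the group product ζ₂(0) * v⁻¹, with v⁻¹ = -v.
    refine ⟨(x₂ 0 - v.1, y₂ 0 - v.2.1,
      (ζ₂ 0).2.2 - v.2.2 - (1 / 2) * ((x₂ 0 - v.1) * v.2.1 - (y₂ 0 - v.2.1) * v.1)), ?_⟩
    rw [rigidMotion, Function.comp_apply, ← hv]
    simp only [leftTranslation, mul, x₂, y₂]
    refine Prod.ext ?_ (Prod.ext ?_ ?_) <;> dsimp only <;> ring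
  have h₃ := h₁.rigidMotion_comp u α
  have hx : ∀ t ∈ Ioo (-T) T, (ζ₂ t).1 = ((rigidMotion u α ∘ ζ₁) t).1 :=
    eqOn_Ioo_of_hasDerivAt (fun t ht => h₂.hasDerivAt_fst ht) (fun t ht => by
      have := h₃.hasDerivAt_fst ht
      rw [h₁.deriv_rigidMotion_comp_fst u α ht] at this
      rwa [hx' t ht]) (by rw [hu, Function.comp_apply])
  have hy : ∀ t ∈ Ioo (-T) T, (ζ₂ t).2.1 = ((rigidMotion u α ∘ ζ₁) t).2.1 :=
    eqOn_Ioo_of_hasDerivAt (fun t ht => h₂.hasDerivAt_snd ht) (fun t ht => by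
      have := h₃.hasDerivAt_snd ht
      rw [h₁.deriv_rigidMotion_comp_snd u α ht] at this
      rwa [hy' t ht]) (by rw [hu, Function.comp_apply])
  have hz : ∀ t ∈ Ioo (-T) T, (ζ₂ t).2.2 = ((rigidMotion u α ∘ ζ₁) t).2.2 :=
    eqOn_Ioo_of_hasDerivAt (fun t ht => h₂.hasDerivAt_trd ht) (fun t ht => by
      have := h₃.hasDerivAt_trd ht
      rwa [h₁.deriv_rigidMotion_comp_fst u α ht, h₁.deriv_rigidMotion_comp_snd u α ht,
        ← hx t ht, ← hy t ht, ← hx' t ht, ← hy' t ht] at this)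
      (by rw [hu, Function.comp_apply])
  exact ⟨u, α, fun t ht => Prod.ext (hx t ht) (Prod.ext (hy t ht) (hz t ht))⟩


/-! ### Lower bounds on length -/

theorem horNorm_nonneg (v : Heis) : 0 ≤ horNorm v := Real.sqrt_nonneg _

theorem ofReal_sub_le_length {γ : ℝ → Heis} {f : ℝ → ℝ} {a b : ℝ} (hab : a ≤ b)
    (hf : AbsolutelyContinuousOnInterval f a b)
    (h : ∀ᵐ t ∂(volume.restrict (Icc a b)), deriv f t ≤ horNorm (deriv γ t)) :
    ENNReal.ofReal (f b - f a) ≤ length γ a b := by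
  have hint : IntegrableOn (deriv f) (Icc a b) := by
    rw [integrableOn_Icc_iff_integrableOn_Ioc]
    exact (intervalIntegrable_iff_integrableOn_Ioc_of_le hab).1 hf.intervalIntegrable_deriv
  rw [← hf.integral_deriv_eq_sub, intervalIntegral.integral_of_le hab,
    ← integral_Icc_eq_integral_Ioc]
  calc ENNReal.ofReal (∫ t in Icc a b, deriv f t)
      ≤ ENNReal.ofReal (∫ t in Icc a b, max (deriv f t) 0) :=
        -- The positive part makes the integrand nonnegative, as the passage to the lower integral
        -- requires.
        ENNReal.ofReal_le_ofReal (integral_mono hint hint.pos_part fun t => le_max_left _ _)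
    _ = ∫⁻ t in Icc a b, ENNReal.ofReal (max (deriv f t) 0) :=
        ofReal_integral_eq_lintegral_ofReal hint.pos_part
          (Filter.Eventually.of_forall fun t => le_max_right _ _)
    _ ≤ length γ a b := by
        refine lintegral_mono_ae ?_
        filter_upwards [h] with t ht
        exact ENNReal.ofReal_le_ofReal (max_le ht (horNorm_nonneg _))

theorem length_mono {γ : ℝ → Heis} {a b c d : ℝ} (h : Icc a b ⊆ Icc c d) :
    length γ a b ≤ length γ c d :=
  lintegral_mono_set h

theorem IsHorizontalCurve.mono {γ : ℝ → Heis} {a b c d : ℝ} (hγ : IsHorizontalCurve γ c d)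
    (h : Icc a b ⊆ Icc c d) : IsHorizontalCurve γ a b := by
  obtain ⟨⟨K, hK⟩, hγ⟩ := hγ
  exact ⟨⟨K, hK.mono h⟩, ae_restrict_of_ae_restrict_of_subset h hγ⟩

theorem IsHorizontalCurve.absolutelyContinuous {γ : ℝ → Heis} {a b : ℝ} (hab : a ≤ b)
    (hγ : IsHorizontalCurve γ a b) {g : Heis → ℝ} (hg : LipschitzWith 1 g) :
    AbsolutelyContinuousOnInterval (fun t => g (γ t)) a b := by
  obtain ⟨⟨K, hK⟩, -⟩ := hγ
  refine LipschitzOnWith.absolutelyContinuousOnInterval (K := 1 * K) ?_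
  rw [uIcc_of_le hab]
  exact hg.comp_lipschitzOnWith hK

theorem lipschitzWith_x : LipschitzWith 1 fun p : Heis => p.1 := LipschitzWith.prod_fst

theorem lipschitzWith_y : LipschitzWith 1 fun p : Heis => p.2.1 := by
  have := LipschitzWith.prod_fst.comp (LipschitzWith.prod_snd (α := ℝ) (β := ℝ × ℝ))
  rwa [one_mul] at this

theorem lipschitzWith_z : LipschitzWith 1 fun p : Heis => p.2.2 := by
  have := LipschitzWith.prod_snd.comp (LipschitzWith.prod_snd (α := ℝ) (β := ℝ × ℝ))
  rwa [one_mul] at this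

/-- Since |x'| is at most the speed, a short competitor stays close to its starting point in x; this
confines it to the calibrated strip. -/
theorem IsHorizontalCurve.abs_x_sub_le_length {γ : ℝ → Heis} {a b t : ℝ}
    (hγ : IsHorizontalCurve γ a b) (ht : t ∈ Icc a b) :
    ENNReal.ofReal |(γ t).1 - (γ a).1| ≤ length γ a b := by
  have hsub : Icc a t ⊆ Icc a b := Icc_subset_Icc_right ht.2
  refine le_trans ?_ (length_mono hsub)
  have hac := (hγ.mono hsub).absolutelyContinuous ht.1 lipschitzWith_x
  have hle : ∀ v : Heis, |v.1| ≤ horNorm v := fun v =>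
    Real.abs_le_sqrt (by nlinarith [sq_nonneg v.2.1])
  rcases abs_cases ((γ t).1 - (γ a).1) with ⟨h, -⟩ | ⟨h, -⟩ <;> rw [h]
  · refine ofReal_sub_le_length ht.1 hac ?_
    filter_upwards [(hγ.mono hsub).2] with s ⟨hs, _⟩
    rw [(hasDerivAt_x hs.hasDerivAt).deriv]
    exact (le_abs_self _).trans (hle _)
  · have := ofReal_sub_le_length (γ := γ) ht.1 hac.neg (by
      filter_upwards [(hγ.mono hsub).2] with s ⟨hs, _⟩
      have := (hasDerivAt_x hs.hasDerivAt).neg.deriv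
      rw [this]
      exact (neg_le_abs _).trans (hle _))
    refine le_trans (le_of_eq ?_) this
    congr 1
    simp only [Pi.neg_apply]
    ring

/-! ### Calibration of arcs of constant deviation -/

/-- The primitive of `x ↦ √(1 - (l x + c)²)`, extended by constants outside the
strip `|l x + c| ≤ 1`. -/
noncomputable def arcPrimitive (l c x : ℝ) : ℝ := ∫ s in (0 : ℝ)..x, √(1 - (l * s + c) ^ 2)

theorem hasDerivAt_arcPrimitive (l c x : ℝ) :
    HasDerivAt (arcPrimitive l c) (√(1 - (l * x + c) ^ 2)) x := by
  have h : Continuous fun s : ℝ => √(1 - (l * s + c) ^ 2) := by fun_prop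
  exact (h.integral_hasStrictDerivAt 0 x).hasDerivAt

/-- `Real.sqrt` vanishes on negative numbers, so the bound also holds outside the strip. It gives
absolute continuity along merely Lipschitz curves. -/
theorem lipschitzWith_arcPrimitive (l c : ℝ) : LipschitzWith 1 (arcPrimitive l c) := by
  refine lipschitzWith_of_nnnorm_deriv_le
    (fun x => (hasDerivAt_arcPrimitive l c x).differentiableAt) fun x => ?_
  rw [(hasDerivAt_arcPrimitive l c x).deriv, ← NNReal.coe_le_coe, coe_nnnorm, Real.norm_eq_abs,
    abs_of_nonneg (Real.sqrt_nonneg _), NNReal.coe_one, Real.sqrt_le_one]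
  nlinarith [sq_nonneg (l * x + c)]

/-- A function whose horizontal gradient `(√(1 - (l x + c)²), l x + c)` has norm one in the
strip `|l x + c| ≤ 1`. -/
noncomputable def calibration (l c : ℝ) (p : Heis) : ℝ :=
  arcPrimitive l c p.1 + (l * (p.2.2 + 1 / 2 * (p.1 * p.2.1)) + c * p.2.1)

/-- Horizontality turns the derivative of z + xy/2 into x y', so the terms in l and c contribute (l
x + c) y'. -/
theorem hasDerivAt_calibration (l c : ℝ) {γ : ℝ → Heis} {v : Heis} {t : ℝ}
    (h : HasDerivAt γ v t) (hv : v ∈ distribution (γ t)) :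
    HasDerivAt (fun s => calibration l c (γ s))
      (√(1 - (l * (γ t).1 + c) ^ 2) * v.1 + (l * (γ t).1 + c) * v.2.1) t := by
  rw [mem_distribution_iff_snd_snd] at hv
  have hx := hasDerivAt_x h
  have hy := hasDerivAt_y h
  have hz := hasDerivAt_z h
  convert! ((hasDerivAt_arcPrimitive l c (γ t).1).comp t hx).add
    (((hz.add ((hx.mul hy).const_mul (1 / 2))).const_mul l).add (hy.const_mul c)) using 1
  rw [hv]
  ring

theorem calibration_sub_le_length (l c : ℝ) {γ : ℝ → Heis} {a b : ℝ} (hab : a ≤ b)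
    (hγ : IsHorizontalCurve γ a b) (h : ∀ t ∈ Icc a b, |l * (γ t).1 + c| ≤ 1) :
    ENNReal.ofReal (calibration l c (γ b) - calibration l c (γ a)) ≤ length γ a b := by
  have hF : AbsolutelyContinuousOnInterval (fun t => arcPrimitive l c (γ t).1) a b :=
    hγ.absolutelyContinuous (g := fun p => arcPrimitive l c p.1) hab (by
      have := (lipschitzWith_arcPrimitive l c).comp lipschitzWith_x
      rwa [one_mul] at this)
  have hx := hγ.absolutelyContinuous hab lipschitzWith_x
  have hy := hγ.absolutelyContinuous hab lipschitzWith_y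
  have hz := hγ.absolutelyContinuous hab lipschitzWith_z
  refine ofReal_sub_le_length hab (f := fun t => calibration l c (γ t))
    (hF.add (((hz.add ((hx.fun_mul hy).const_mul (1 / 2))).const_mul l).add (hy.const_mul c))) ?_
  filter_upwards [hγ.2, ae_restrict_mem measurableSet_Icc] with t ⟨h1, h2⟩ ht
  rw [(hasDerivAt_calibration l c h1.hasDerivAt h2).deriv]
  refine Real.le_sqrt_of_sq_le ?_
  have h3 : (l * (γ t).1 + c) ^ 2 ≤ 1 := (sq_le_one_iff_abs_le_one _).2 (h t ht)
  have h4 := Real.sq_sqrt (sub_nonneg.2 h3)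
  set r := √(1 - (l * (γ t).1 + c) ^ 2)
  set w := l * (γ t).1 + c
  -- Cauchy–Schwarz against the unit vector (r, w); the square is the defect in Lagrange's identity.
  nlinarith [sq_nonneg (r * (deriv γ t).2.1 - w * (deriv γ t).1)]

/-- A minimality criterion: an arc on which `y' = l x + c` and `x' = √(1 - y'²)`, as long as it
stays far enough from the boundary of the calibrated strip. -/
theorem ofReal_sub_le_ccDist {ζ : ℝ → Heis} {l c s t : ℝ} (hst : s ≤ t)
    (hζ : ∀ r ∈ Icc s t, HasDerivAt ζ (deriv ζ r) r)
    (hhor : ∀ r ∈ Icc s t, deriv ζ r ∈ distribution (ζ r))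
    (hx : ∀ r ∈ Icc s t, (deriv ζ r).1 = √(1 - (l * (ζ r).1 + c) ^ 2))
    (hy : ∀ r ∈ Icc s t, (deriv ζ r).2.1 = l * (ζ r).1 + c)
    (hle : ∀ r ∈ Icc s t, |l * (ζ r).1 + c| ≤ 1)
    (hclose : |l * (ζ s).1 + c| + |l| * (t - s) ≤ 1) :
    ENNReal.ofReal (t - s) ≤ ccDist (ζ s) (ζ t) := by
  refine le_sInf ?_
  rintro L ⟨a, b, γ, hab, hγ, ha, hb, rfl⟩
  by_contra! hlt
  have hS : calibration l c (ζ t) - calibration l c (ζ s) = t - s := by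
    have hder : ∀ r ∈ uIcc s t, HasDerivAt (fun r => calibration l c (ζ r)) 1 r := fun r hr => by
      rw [uIcc_of_le hst] at hr
      have h1 := hasDerivAt_calibration l c (hζ r hr) (hhor r hr)
      rw [hx r hr, hy r hr] at h1
      convert! h1 using 1
      have h2 := Real.mul_self_sqrt (sub_nonneg.2 ((sq_le_one_iff_abs_le_one _).2 (hle r hr)))
      linear_combination -h2
    have := intervalIntegral.integral_eq_sub_of_hasDerivAt hder (by simp)
    simpa using this.symm
  -- A competitor shorter than t - s moves x by at most t - s, hence l x + c by at most |l| (t - s),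
  -- which `hclose` allows.
  have hstrip : ∀ r ∈ Icc a b, |l * (γ r).1 + c| ≤ 1 := fun r hr => by
    have h1 := (hγ.abs_x_sub_le_length hr).trans hlt.le
    rw [ENNReal.ofReal_le_ofReal_iff (sub_nonneg.2 hst), ha] at h1
    have h2 : l * (γ r).1 + c = (l * (ζ s).1 + c) + l * ((γ r).1 - (ζ s).1) := by ring
    rw [h2]
    refine (abs_add_le _ _).trans (le_trans ?_ hclose)
    rw [abs_mul]
    gcongr
  have := calibration_sub_le_length l c hab hγ hstrip
  rw [ha, hb, hS] at this
  exact absurd this (not_le.2 hlt)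

/-! ### Constant deviation implies geodesic -/

theorem isHorizontalCurve_of_continuousOn_deriv {γ v : ℝ → Heis} {a b : ℝ}
    (hγ : ∀ t ∈ Icc a b, HasDerivAt γ (v t) t) (hv : ContinuousOn v (Icc a b))
    (hhor : ∀ t ∈ Icc a b, v t ∈ distribution (γ t)) : IsHorizontalCurve γ a b := by
  refine ⟨?_, ?_⟩
  · obtain ⟨C, hC⟩ := isCompact_Icc.exists_bound_of_continuousOn hv
    refine ⟨C.toNNReal, (convex_Icc a b).lipschitzOnWith_of_nnnorm_hasDerivWithin_le
      (fun t ht => (hγ t ht).hasDerivWithinAt) fun t ht => ?_⟩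
    rw [← NNReal.coe_le_coe, coe_nnnorm]
    exact (hC t ht).trans (Real.le_coe_toNNReal C)
  · filter_upwards [ae_restrict_mem measurableSet_Icc] with t ht
    refine ⟨(hγ t ht).differentiableAt, ?_⟩
    rw [(hγ t ht).deriv]
    exact hhor t ht

namespace IsSmoothArcLengthCurve

variable {ζ : ℝ → Heis} {T : ℝ}

theorem isHorizontalCurve (h : IsSmoothArcLengthCurve ζ T) {a b : ℝ} (hab : Icc a b ⊆ Ioo (-T) T) :
    IsHorizontalCurve ζ a b :=
  isHorizontalCurve_of_continuousOn_deriv (fun _ ht => h.hasDerivAt (hab ht))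
    ((h.smooth.continuousOn_deriv_of_isOpen isOpen_Ioo (by simp)).mono hab)
    fun t ht => h.horizontal t (hab ht)

theorem length_eq (h : IsSmoothArcLengthCurve ζ T) {a b : ℝ} (hab : Icc a b ⊆ Ioo (-T) T) :
    length ζ a b = ENNReal.ofReal (b - a) := by
  unfold length
  rw [setLIntegral_congr_fun (g := fun _ => 1) measurableSet_Icc fun t ht => by
    simp only [h.unit_speed t (hab ht), ENNReal.ofReal_one]]
  simp

theorem exists_rotation (h : IsSmoothArcLengthCurve ζ T) {t₀ : ℝ} (ht₀ : t₀ ∈ Ioo (-T) T) :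
    ∃ α, deriv (fun s => ((rigidMotion 0 α ∘ ζ) s).1) t₀ = 1 ∧
      deriv (fun s => ((rigidMotion 0 α ∘ ζ) s).2.1) t₀ = 0 := by
  obtain ⟨α, hc, hs⟩ := exists_cos_sin_eq (h.sq_add_sq ht₀)
  refine ⟨α, ?_, ?_⟩
  · rw [h.deriv_rigidMotion_comp_fst 0 α ht₀, hc, hs]
    linear_combination h.sq_add_sq ht₀
  · rw [h.deriv_rigidMotion_comp_snd 0 α ht₀, hc, hs]
    ring

/-- A curve of constant characteristic deviation with initial velocity `X₁` is locally
minimizing. -/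
theorem eventually_ccDist_eq_of_charDev_const (h : IsSmoothArcLengthCurve ζ T) {l t₀ : ℝ}
    (ht₀ : t₀ ∈ Ioo (-T) T) (hl : ∀ t ∈ Ioo (-T) T, charDev ζ t = l)
    (hx₀ : deriv (fun s => (ζ s).1) t₀ = 1) (hy₀ : deriv (fun s => (ζ s).2.1) t₀ = 0) :
    ∀ᶠ s in 𝓝 t₀, ccDist (ζ (min t₀ s)) (ζ (max t₀ s)) =
      ENNReal.ofReal (max t₀ s - min t₀ s) := by
  -- Chosen so that l x + c vanishes at t₀, as y' does; both have derivative l x'.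
  set c := -(l * (ζ t₀).1) with hc
  have hy : ∀ t ∈ Ioo (-T) T, deriv (fun s => (ζ s).2.1) t = l * (ζ t).1 + c := fun t ht =>
    isOpen_Ioo.eqOn_of_deriv_eq isPreconnected_Ioo
      (g := fun t => l * (ζ t).1 + c)
      (fun t ht => (h.hasDerivAt_deriv_snd ht).differentiableAt.differentiableWithinAt)
      (fun t ht => (((h.hasDerivAt_fst ht).const_mul l).add_const c
        ).differentiableAt.differentiableWithinAt)
      (fun t ht => by
        rw [(h.hasDerivAt_deriv_snd ht).deriv,
          (((h.hasDerivAt_fst ht).const_mul l).add_const c).deriv, hl t ht])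
      ht₀ (by rw [hy₀, hc]; ring) ht
  -- Near t₀, x' > 0 selects the positive square root, and the two bounds by 1/2 that follow add up
  -- to the bound 1 of `hclose`.
  have hcx : ∀ᶠ s in 𝓝 t₀, 0 < deriv (fun s => (ζ s).1) s :=
    (h.hasDerivAt_deriv_fst ht₀).continuousAt.eventually_const_lt (by rw [hx₀]; exact one_pos)
  have hcy : ∀ᶠ s in 𝓝 t₀, |deriv (fun s => (ζ s).2.1) s| < 1 / 2 :=
    (h.hasDerivAt_deriv_snd ht₀).continuousAt.abs.eventually_lt_const (by simp [hy₀])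
  have hcl : ∀ᶠ s in 𝓝 t₀, |l| * (max t₀ s - min t₀ s) < 1 / 2 := by
    have : Continuous fun s => |l| * (max t₀ s - min t₀ s) := by fun_prop
    exact this.continuousAt.eventually_lt_const (by simp)
  obtain ⟨ε, hε, hball⟩ := Metric.eventually_nhds_iff_ball.1
    (hcx.and (hcy.and (isOpen_Ioo.eventually_mem ht₀)))
  filter_upwards [hcl, Metric.ball_mem_nhds t₀ hε] with s hs1 hs2
  have hsub : ∀ r ∈ Icc (min t₀ s) (max t₀ s), r ∈ Metric.ball t₀ ε := by
    have hconv := (convex_ball t₀ ε).ordConnected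
    intro r hr
    exact hconv.uIcc_subset (Metric.mem_ball_self hε) hs2 hr
  have hI : Icc (min t₀ s) (max t₀ s) ⊆ Ioo (-T) T := fun r hr => (hball r (hsub r hr)).2.2
  have hle : ∀ r ∈ Icc (min t₀ s) (max t₀ s), |l * (ζ r).1 + c| < 1 / 2 := fun r hr => by
    rw [← hy r (hI hr)]
    exact (hball r (hsub r hr)).2.1
  refine le_antisymm ?_ ?_
  · rw [← h.length_eq hI]
    exact ccDist_le_length min_le_max (h.isHorizontalCurve hI)
  · refine ofReal_sub_le_ccDist (l := l) (c := c) min_le_max (fun r hr => h.hasDerivAt (hI hr))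
      (fun r hr => h.horizontal r (hI hr)) (fun r hr => ?_) (fun r hr => ?_)
      (fun r hr => (hle r hr).le.trans (by norm_num)) ?_
    · rw [← hy r (hI hr), ← h.deriv_fst (hI hr), ← h.sq_add_sq (hI hr), add_sub_cancel_right,
        Real.sqrt_sq (hball r (hsub r hr)).1.le]
    · rw [← hy r (hI hr), h.deriv_snd (hI hr)]
    · have := hle _ (left_mem_Icc.2 min_le_max)
      linarith

theorem isGeodesicOn_of_deriv_charDev_eq_zero (h : IsSmoothArcLengthCurve ζ T)
    (hd : ∀ t ∈ Ioo (-T) T, deriv (charDev ζ) t = 0) : IsGeodesicOn ζ (Ioo (-T) T) := by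
  refine ⟨fun a b hab => h.isHorizontalCurve hab, ⟨1, ?_⟩, fun t₀ ht₀ => ?_⟩
  · filter_upwards [ae_restrict_mem measurableSet_Ioo] with t ht using h.unit_speed t ht
  obtain ⟨α, hx₀, hy₀⟩ := h.exists_rotation ht₀
  have hl : ∀ t ∈ Ioo (-T) T, charDev (rigidMotion 0 α ∘ ζ) t = charDev ζ t₀ := fun t ht => by
    rw [h.charDev_rigidMotion_comp 0 α ht]
    exact isOpen_Ioo.is_const_of_deriv_eq_zero isPreconnected_Ioo
      (fun s hs => (hasDerivAt_of_contDiffOn h.contDiffOn_charDev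
        hs).differentiableAt.differentiableWithinAt) hd ht ht₀
  have key := (h.rigidMotion_comp 0 α).eventually_ccDist_eq_of_charDev_const ht₀ hl hx₀ hy₀
  filter_upwards [key.filter_mono nhdsWithin_le_nhds, self_mem_nhdsWithin] with s hs hsI
  have hI : Icc (min t₀ s) (max t₀ s) ⊆ Ioo (-T) T := ordConnected_Ioo.uIcc_subset ht₀ hsI
  rw [Function.comp_apply, Function.comp_apply, ccDist_rigidMotion] at hs
  rw [h.length_eq hI, ← hs]
  rcases le_total t₀ s with hts | hts
  · rw [min_eq_left hts, max_eq_right hts]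
  · rw [min_eq_right hts, max_eq_left hts, ccDist_comm]

end IsSmoothArcLengthCurve

/-! ### Tools for the converse: projection and energy -/

/-- The orthogonal projection in `L²` of a continuous function to the span of `1` and `x`. -/
theorem exists_affine_projection {x f : ℝ → ℝ} {a b : ℝ} (hab : a < b)
    (hx : ContinuousOn x (Icc a b)) (hf : ContinuousOn f (Icc a b)) (hne : x a ≠ x b) :
    ∃ A B : ℝ, ∫ t in a..b, (f t - (A + B * x t)) = 0 ∧
      ∫ t in a..b, x t * (f t - (A + B * x t)) = 0 := by
  have hint : ∀ {φ : ℝ → ℝ}, ContinuousOn φ (Icc a b) → IntervalIntegrable φ volume a b :=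
    fun h => (by rwa [uIcc_of_le hab.le] : ContinuousOn _ (uIcc a b)).intervalIntegrable
  set I₀ := b - a with hI₀
  set I₁ := ∫ t in a..b, x t with hI₁
  set I₂ := ∫ t in a..b, x t * x t with hI₂
  set J₀ := ∫ t in a..b, f t with hJ₀
  set J₁ := ∫ t in a..b, x t * f t with hJ₁
  have hpos : 0 < I₀ := sub_pos.2 hab
  have hx2 := hx.fun_mul hx
  -- The Gram determinant of 1 and x, times I₀, is the integral of (I₀ x - I₁)²; it is positive
  -- because x is not constant.
  have hD : 0 < I₀ * (I₀ * I₂ - I₁ ^ 2) := by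
    have h1 : ∫ t in a..b, (I₀ * x t - I₁) ^ 2 = I₀ * (I₀ * I₂ - I₁ ^ 2) := by
      have h2 : ∀ t, (I₀ * x t - I₁) ^ 2
          = I₀ ^ 2 * (x t * x t) - 2 * I₀ * I₁ * x t + I₁ ^ 2 := fun t => by ring
      simp_rw [h2]
      rw [intervalIntegral.integral_add (hint ((hx2.const_mul _).fun_sub (hx.const_mul _)))
        intervalIntegrable_const, intervalIntegral.integral_sub (hint (hx2.const_mul _)) (hint (hx.const_mul _)),
        intervalIntegral.integral_const_mul, intervalIntegral.integral_const_mul,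
        intervalIntegral.integral_const, smul_eq_mul, ← hI₂, ← hI₁, ← hI₀]
      ring
    rw [← h1]
    refine intervalIntegral.integral_pos hab (((hx.const_mul _).sub continuousOn_const).pow 2)
      (fun t _ => sq_nonneg _) ?_
    by_contra! hcon
    have h3 : ∀ t ∈ Icc a b, I₀ * x t - I₁ = 0 := fun t ht =>
      pow_eq_zero_iff two_ne_zero |>.1 (le_antisymm (hcon t ht) (sq_nonneg _))
    refine hne (mul_left_cancel₀ hpos.ne' ?_)
    linarith [h3 a (left_mem_Icc.2 hab.le), h3 b (right_mem_Icc.2 hab.le)]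
  have hD' : I₀ * I₂ - I₁ ^ 2 ≠ 0 := fun h => by simp [h] at hD
  set B := (I₀ * J₁ - I₁ * J₀) / (I₀ * I₂ - I₁ ^ 2) with hB
  refine ⟨(J₀ - B * I₁) / I₀, B, ?_, ?_⟩
  · rw [intervalIntegral.integral_sub (hint hf)
      (hint (continuousOn_const.fun_add (hx.const_mul _))),
      intervalIntegral.integral_add intervalIntegrable_const (hint (hx.const_mul _)),
      intervalIntegral.integral_const_mul, intervalIntegral.integral_const, smul_eq_mul,
      ← hI₁, ← hI₀, ← hJ₀]
    field_simp
    ring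
  · have h2 : ∀ t, x t * (f t - ((J₀ - B * I₁) / I₀ + B * x t))
        = x t * f t - ((J₀ - B * I₁) / I₀ * x t + B * (x t * x t)) := fun t => by ring
    simp_rw [h2]
    rw [intervalIntegral.integral_sub (hint (hx.fun_mul hf))
      (hint ((hx.const_mul _).fun_add (hx2.const_mul _))),
      intervalIntegral.integral_add (hint (hx.const_mul _)) (hint (hx2.const_mul _)),
      intervalIntegral.integral_const_mul, intervalIntegral.integral_const_mul,
      ← hI₁, ← hI₂, ← hJ₁, hB]
    field_simp
    ring

/-- By √e ≤ (1 + e)/2, with equality at unit speed. The bound is quadratic in the velocity, so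
orthogonality can be used without reparametrizing the competitor. -/
theorem length_le_integral {γ v : ℝ → Heis} {a b : ℝ} (hab : a ≤ b)
    (hγ : ∀ t ∈ Icc a b, HasDerivAt γ (v t) t) (hv : ContinuousOn v (Icc a b)) :
    length γ a b ≤ ENNReal.ofReal (∫ t in a..b, (1 + ((v t).1 ^ 2 + (v t).2.1 ^ 2)) / 2) := by
  have hc : ContinuousOn (fun t => (1 + ((v t).1 ^ 2 + (v t).2.1 ^ 2)) / 2) (Icc a b) := by
    have h1 : ContinuousOn (fun t => (v t).1) (Icc a b) := continuous_fst.comp_continuousOn hv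
    have h2 : ContinuousOn (fun t => (v t).2.1) (Icc a b) :=
      (continuous_fst.comp continuous_snd).comp_continuousOn hv
    fun_prop
  rw [intervalIntegral.integral_of_le hab, ← integral_Icc_eq_integral_Ioc,
    ofReal_integral_eq_lintegral_ofReal hc.integrableOn_Icc
      (Filter.Eventually.of_forall fun t => by positivity)]
  refine setLIntegral_mono' measurableSet_Icc fun t ht => ENNReal.ofReal_le_ofReal ?_
  rw [(hγ t ht).deriv, horNorm]
  refine Real.sqrt_le_iff.2 ⟨by positivity, ?_⟩
  nlinarith [sq_nonneg ((v t).1 ^ 2 + (v t).2.1 ^ 2 - 1)]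

theorem hasDerivAt_integral_of_continuousOn_Ioo {f : ℝ → ℝ} {T a t : ℝ}
    (hf : ContinuousOn f (Ioo (-T) T)) (ha : a ∈ Ioo (-T) T) (ht : t ∈ Ioo (-T) T) :
    HasDerivAt (fun u => ∫ s in a..u, f s) (f t) t :=
  intervalIntegral.integral_hasDerivAt_right
    (hf.mono (ordConnected_Ioo.uIcc_subset ha ht)).intervalIntegrable
    (hf.stronglyMeasurableAtFilter isOpen_Ioo t ht) (hf.continuousAt (isOpen_Ioo.mem_nhds ht))

/-! ### Geodesics have constant deviation -/

namespace IsSmoothArcLengthCurve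

variable {ζ : ℝ → Heis} {T : ℝ}

/-- On a minimizing arc, `y'` is an affine function of `x`. -/
theorem exists_deriv_snd_eq_affine (h : IsSmoothArcLengthCurve ζ T) {a b : ℝ} (hab : a < b)
    (hI : Icc a b ⊆ Ioo (-T) T) (hne : (ζ a).1 ≠ (ζ b).1)
    (hmin : ENNReal.ofReal (b - a) ≤ ccDist (ζ a) (ζ b)) :
    ∃ A B : ℝ, ∀ t ∈ Icc a b, deriv (fun s => (ζ s).2.1) t = A + B * (ζ t).1 := by
  set x := fun s => (ζ s).1 with hxdef
  set y := fun s => (ζ s).2.1 with hydef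
  have hx : ContinuousOn x (Ioo (-T) T) := h.contDiffOn_x.continuousOn
  have hx' : ContinuousOn (deriv x) (Ioo (-T) T) := h.contDiffOn_deriv_x.continuousOn
  have hy' : ContinuousOn (deriv y) (Ioo (-T) T) := h.contDiffOn_deriv_y.continuousOn
  have ha := hI (left_mem_Icc.2 hab.le)
  have hb := hI (right_mem_Icc.2 hab.le)
  have hint : ∀ {φ : ℝ → ℝ}, ContinuousOn φ (Ioo (-T) T) → IntervalIntegrable φ volume a b :=
    fun h => (h.mono (ordConnected_Ioo.uIcc_subset ha hb)).intervalIntegrable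
  obtain ⟨A, B, h0, h1⟩ := exists_affine_projection hab (hx.mono hI) (hy'.mono hI) hne
  refine ⟨A, B, ?_⟩
  set k := fun t => A + B * x t with hkdef
  have hk : ContinuousOn k (Ioo (-T) T) := continuousOn_const.add (hx.const_mul _)
  have hg : ContinuousOn (fun t => deriv y t - k t) (Ioo (-T) T) := hy'.sub hk
  set Y := fun t => y a + ∫ s in a..t, k s with hYdef
  -- W plays the role of z + xy/2, whose derivative along the competitor must be x k for
  -- horizontality; z is then recovered as W - xY/2.
  set W := fun t => (ζ a).2.2 + 1 / 2 * (x a * y a) + ∫ s in a..t, x s * k s with hWdef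
  set γ : ℝ → Heis := fun t => (x t, Y t, W t - 1 / 2 * (x t * Y t)) with hγdef
  set v : ℝ → Heis := fun t => (deriv x t, k t, (x t * k t - Y t * deriv x t) / 2) with hvdef
  have hY : ∀ t ∈ Ioo (-T) T, HasDerivAt Y (k t) t := fun t ht =>
    (hasDerivAt_integral_of_continuousOn_Ioo hk ha ht).const_add _
  have hW : ∀ t ∈ Ioo (-T) T, HasDerivAt W (x t * k t) t := fun t ht =>
    (hasDerivAt_integral_of_continuousOn_Ioo (hx.mul hk) ha ht).const_add _
  have hγ : ∀ t ∈ Ioo (-T) T, HasDerivAt γ (v t) t := fun t ht => by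
    have hxt := h.hasDerivAt_fst ht
    convert! hxt.prodMk ((hY t ht).prodMk ((hW t ht).sub
      ((hxt.mul (hY t ht)).const_mul (1 / 2)))) using 1
    simp only [hvdef, Prod.mk.injEq, true_and]
    refine ⟨rfl, ?_⟩
    ring
  have hYc : ContinuousOn Y (Ioo (-T) T) := fun t ht => (hY t ht).continuousAt.continuousWithinAt
  have hv : ContinuousOn v (Icc a b) := by
    refine ContinuousOn.mono ?_ hI
    exact hx'.prodMk (hk.prodMk (((hx.mul hk).sub (hYc.mul hx')).div_const 2))
  have hhor : ∀ t ∈ Icc a b, v t ∈ distribution (γ t) := fun t _ =>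
    (mem_distribution_iff_snd_snd _ _).2 rfl
  have hγa : γ a = ζ a := by
    simp only [hγdef, hYdef, hWdef, intervalIntegral.integral_same, add_zero,
      add_sub_cancel_right]
    rfl
  have hYb : Y b = y b := by
    have h2 : ∫ t in a..b, deriv y t = y b - y a :=
      intervalIntegral.integral_eq_sub_of_hasDerivAt
        (fun t ht => h.hasDerivAt_snd (ordConnected_Ioo.uIcc_subset ha hb ht)) (hint hy')
    rw [intervalIntegral.integral_sub (hint hy') (hint hk)] at h0
    simp only [hYdef]
    linarith
  have hWb : W b = (ζ b).2.2 + 1 / 2 * (x b * y b) := by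
    have h2 : ∫ t in a..b, x t * deriv y t
        = ((ζ b).2.2 + 1 / 2 * (x b * y b)) - ((ζ a).2.2 + 1 / 2 * (x a * y a)) := by
      refine intervalIntegral.integral_eq_sub_of_hasDerivAt
        (f := fun t => (ζ t).2.2 + 1 / 2 * (x t * y t)) (fun t ht => ?_) (hint (hx.fun_mul hy'))
      have ht := ordConnected_Ioo.uIcc_subset ha hb ht
      convert! (h.hasDerivAt_trd ht).add
        (((h.hasDerivAt_fst ht).mul (h.hasDerivAt_snd ht)).const_mul (1 / 2)) using 1
      ring
    have h3 : ∀ t, x t * (deriv y t - k t) = x t * deriv y t - x t * k t := fun t => mul_sub _ _ _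
    change ∫ t in a..b, x t * (deriv y t - k t) = 0 at h1
    simp_rw [h3] at h1
    rw [intervalIntegral.integral_sub (hint (hx.fun_mul hy')) (hint (hx.fun_mul hk))] at h1
    simp only [hWdef]
    linarith
  have hγb : γ b = ζ b := by
    simp only [hγdef, hYb, hWb, add_sub_cancel_right]
    rfl
  have hlen := ccDist_le_length hab.le (isHorizontalCurve_of_continuousOn_deriv
    (fun t ht => hγ t (hI ht)) hv hhor)
  rw [hγa, hγb] at hlen
  have hle := hmin.trans (hlen.trans (length_le_integral hab.le (fun t ht => hγ t (hI ht)) hv))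
  rw [ENNReal.ofReal_le_ofReal_iff'] at hle
  have hle := hle.resolve_right (not_le.2 (sub_pos.2 hab))
  -- Pythagoras: y' - k is orthogonal to 1 and x, hence to k = A + B x, and x'² + y'² = 1.
  have henergy : ∫ t in a..b, (1 + ((v t).1 ^ 2 + (v t).2.1 ^ 2)) / 2
      = (b - a) - 1 / 2 * ∫ t in a..b, (deriv y t - k t) ^ 2 := by
    have h2 : ∀ t ∈ uIcc a b, (1 + ((v t).1 ^ 2 + (v t).2.1 ^ 2)) / 2
        = 1 - 1 / 2 * (deriv y t - k t) ^ 2 - (A * (deriv y t - k t)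
          + B * (x t * (deriv y t - k t))) := fun t ht => by
      have := h.sq_add_sq (ordConnected_Ioo.uIcc_subset ha hb ht)
      change deriv x t ^ 2 + deriv y t ^ 2 = 1 at this
      simp only [hvdef, hkdef]
      linear_combination (1 / 2) * this
    rw [intervalIntegral.integral_congr h2,
      intervalIntegral.integral_sub
        (hint (continuousOn_const.fun_sub ((hg.fun_pow 2).const_mul _)))
        (hint ((hg.const_mul _).fun_add ((hx.fun_mul hg).const_mul _))),
      intervalIntegral.integral_sub intervalIntegrable_const (hint ((hg.fun_pow 2).const_mul _)),
      intervalIntegral.integral_add (hint (hg.const_mul _)) (hint ((hx.fun_mul hg).const_mul _)),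
      intervalIntegral.integral_const_mul, intervalIntegral.integral_const_mul,
      intervalIntegral.integral_const_mul, h0, h1]
    simp
  rw [henergy] at hle
  by_contra! hcon
  obtain ⟨t, ht, hne'⟩ := hcon
  have := intervalIntegral.integral_pos hab ((hg.fun_pow 2).mono hI) (fun t _ => sq_nonneg _)
    ⟨t, ht, sq_pos_of_ne_zero (sub_ne_zero.2 hne')⟩
  linarith

/-- Differentiating y' = A + B x gives h x' = B x', and x' > 0 can be cancelled. Positivity also
separates the end values of x, as the projection requires. -/
theorem charDev_eq_const_of_minimizing (h : IsSmoothArcLengthCurve ζ T) {a b : ℝ} (hab : a < b)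
    (hI : Icc a b ⊆ Ioo (-T) T) (hpos : ∀ t ∈ Icc a b, 0 < deriv (fun s => (ζ s).1) t)
    (hmin : ENNReal.ofReal (b - a) ≤ ccDist (ζ a) (ζ b)) :
    ∃ B : ℝ, ∀ t ∈ Icc a b, charDev ζ t = B := by
  have hmono : StrictMonoOn (fun s => (ζ s).1) (Icc a b) :=
    strictMonoOn_of_deriv_pos (convex_Icc a b) (h.contDiffOn_x.continuousOn.mono hI)
      fun t ht => hpos t (interior_subset ht)
  have hne := (hmono (left_mem_Icc.2 hab.le) (right_mem_Icc.2 hab.le) hab).ne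
  obtain ⟨A, B, hAB⟩ := h.exists_deriv_snd_eq_affine hab hI hne hmin
  refine ⟨B, fun t ht => ?_⟩
  have h1 := (h.hasDerivAt_deriv_snd (hI ht)).hasDerivWithinAt (s := Icc a b)
  have h2 := (((h.hasDerivAt_fst (hI ht)).const_mul B).const_add A).hasDerivWithinAt
    (s := Icc a b)
  have h3 := (uniqueDiffOn_Icc hab t ht).eq_deriv _ h1 (h2.congr hAB (hAB t ht))
  exact mul_right_cancel₀ (hpos t ht).ne' h3

theorem deriv_charDev_eq_zero_of_isGeodesicOn (h : IsSmoothArcLengthCurve ζ T)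
    (hgeo : IsGeodesicOn ζ (Ioo (-T) T)) : ∀ t ∈ Ioo (-T) T, deriv (charDev ζ) t = 0 := by
  intro t₀ ht₀
  obtain ⟨α, hx₀, -⟩ := h.exists_rotation ht₀
  have hr := h.rigidMotion_comp 0 α
  have hcx : ∀ᶠ s in 𝓝 t₀, 0 < deriv (fun s => ((rigidMotion 0 α ∘ ζ) s).1) s :=
    (hr.hasDerivAt_deriv_fst ht₀).continuousAt.eventually_const_lt (by rw [hx₀]; exact one_pos)
  have hmin := hgeo.2.2 t₀ ht₀
  rw [isOpen_Ioo.nhdsWithin_eq ht₀] at hmin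
  obtain ⟨ε, hε, hball⟩ := Metric.eventually_nhds_iff_ball.1
    (hcx.and (hmin.and (isOpen_Ioo.eventually_mem ht₀)))
  have hb : t₀ < t₀ + ε / 2 := by linarith
  set b := t₀ + ε / 2 with hbdef
  have hsub : ∀ r ∈ Icc t₀ b, r ∈ Metric.ball t₀ ε := fun r hr => by
    rw [Metric.mem_ball, Real.dist_eq, abs_of_nonneg (sub_nonneg.2 hr.1)]
    linarith [hr.2]
  have hI : Icc t₀ b ⊆ Ioo (-T) T := fun r hr => (hball r (hsub r hr)).2.2
  have hd := (hball b (hsub b (right_mem_Icc.2 hb.le))).2.1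
  rw [min_eq_left hb.le, max_eq_right hb.le, h.length_eq hI] at hd
  obtain ⟨B, hB⟩ := hr.charDev_eq_const_of_minimizing hb hI
    (fun r hr => (hball r (hsub r hr)).1)
    (by rw [Function.comp_apply, Function.comp_apply, ccDist_rigidMotion, hd])
  have hB' : ∀ t ∈ Icc t₀ b, charDev ζ t = B := fun t ht => by
    rw [← hB t ht, h.charDev_rigidMotion_comp 0 α (hI ht)]
  have ht₀b := left_mem_Icc.2 hb.le
  -- The deviation is known to be constant only to the right of t₀; as it is differentiable at t₀,
  -- its one-sided derivative suffices.
  exact (uniqueDiffOn_Icc hb t₀ ht₀b).eq_deriv _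
    (hasDerivAt_of_contDiffOn h.contDiffOn_charDev ht₀).hasDerivWithinAt
    ((hasDerivWithinAt_const t₀ (Icc t₀ b) B).congr hB' (hB' t₀ ht₀b))

end IsSmoothArcLengthCurve

end Heis

theorem mainTheorem2 (T : ℝ) (hT : 0 < T) :
    (∀ ζ₁ ζ₂ : ℝ → Heis,
      Heis.IsSmoothArcLengthCurve ζ₁ T → Heis.IsSmoothArcLengthCurve ζ₂ T →
      (∀ t ∈ Ioo (-T) T, Heis.charDev ζ₁ t = Heis.charDev ζ₂ t) →
      ∃ ι : Heis → Heis, Heis.IsHeisIsometry ι ∧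
        (∃ (u : Heis) (α : ℝ), ι = Heis.leftTranslation u ∘ Heis.rotation α) ∧
        ∀ t ∈ Ioo (-T) T, ζ₂ t = ι (ζ₁ t)) ∧
    (∀ ζ : ℝ → Heis, Heis.IsSmoothArcLengthCurve ζ T →
      ((∀ t ∈ Ioo (-T) T, deriv (Heis.charDev ζ) t = 0) ↔
        Heis.IsGeodesicOn ζ (Ioo (-T) T))) := by
  refine ⟨fun ζ₁ ζ₂ h₁ h₂ h => ?_, fun ζ h =>
    ⟨h.isGeodesicOn_of_deriv_charDev_eq_zero, h.deriv_charDev_eq_zero_of_isGeodesicOn⟩⟩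
  obtain ⟨u, α, hu⟩ := Heis.exists_rigidMotion_of_charDev_eq hT h₁ h₂ h
  exact ⟨Heis.rigidMotion u α, Heis.isHeisIsometry_rigidMotion u α, ⟨u, α, rfl⟩, hu⟩
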